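/- All graphs are finite and simple. For an edge-coloured graph (adjacent edges may receive the same colour), a path is called \emph{proper} if no two adjacent edges of the path have the same colour. For a connected graph $G$, the \emph{proper connection number} $pc(G)$ is the minimum number of colours in an edge-colouring of $G$ such that every two distinct vertices of $G$ are connected by a proper path. For $a,b\ge 1$, let $T(a,b)$ denote the double star whose two adjacent centres have degrees $a$ and $b$, that is, the tree on $a+b$ vertices obtained from an edge $uv$ by attaching $a-1$ leaves to $u$ and $b-1$ leaves to $v$. \textbf{Theorem.} Let $G$ be a graph on $n\ge 5$ vertices such that both $G$ and its complement $\overline{G}$ are connected. Then $$4\le pc(G)+pc(\overline{G})\le n,$$ and $pc(G)+pc(\overline{G})=n$ if and only if $G\cong T(2,n-2)$ or $\overline{G}\cong T(2,n-2)$. -/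

import Mathlib

namespace SimpleGraph

universe u v

variable {V : Type u} {K : Type v}

/-- A walk of the edge-coloured graph `G` is a proper path if it is a path and any two
consecutive edges of it (in a path these are the pairs of adjacent edges) have different colours. -/
def Walk.IsProperPath {G : SimpleGraph V} (c : G.EdgeLabeling K) {x y : V} (p : G.Walk x y) :
    Prop :=
  p.IsPath ∧ (p.darts.map fun d => c.get d.fst d.snd d.adj).IsChain (· ≠ ·)

/-- Every two distinct vertices are joined by a proper path. Adjacent edges may have the same
colour. -/
def EdgeLabeling.IsProperPathColoring {G : SimpleGraph V} (c : G.EdgeLabeling K) : Prop :=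
  ∀ x y : V, x ≠ y → ∃ p : G.Walk x y, p.IsProperPath c

/-- The proper connection number `pc(G)`: the least number of colours of a proper-path colouring
of `G`. For a finite connected graph such a colouring exists
(`exists_isProperPathColoring`), so the minimum is attained. -/
noncomputable def properConnectionNumber (G : SimpleGraph V) : ℕ :=
  sInf {k : ℕ | ∃ c : G.EdgeLabeling (Fin k), c.IsProperPathColoring}

theorem exists_isProperPathColoring [Finite V] {G : SimpleGraph V} (hG : G.Connected) :
    ∃ k : ℕ, ∃ c : G.EdgeLabeling (Fin k), c.IsProperPathColoring := by
  classical
  obtain ⟨k, ⟨e⟩⟩ := Finite.exists_equiv_fin G.edgeSet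
  refine ⟨k, fun a => e a, fun x y _ => ?_⟩
  obtain ⟨p, hp⟩ := hG.exists_isPath x y
  refine ⟨p, hp, ?_⟩
  rw [List.isChain_map]
  have h : p.darts.Pairwise fun d d' => d.edge ≠ d'.edge :=
    List.pairwise_map.mp hp.isTrail.edges_nodup
  refine h.isChain.imp fun d d' hne heq => hne ?_
  exact congrArg Subtype.val (e.injective heq)

/-- The double star `T(a, b)` (for `a, b ≥ 1`): two adjacent centres `inl none` and `inr none`,
of degrees `a` and `b`, so that `a - 1` leaves hang on the first and `b - 1` on the second. -/
def doubleStar (a b : ℕ) : SimpleGraph (Option (Fin (a - 1)) ⊕ Option (Fin (b - 1))) :=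
  SimpleGraph.fromRel fun x y =>
    (x = Sum.inl none ∧ y = Sum.inr none) ∨
    (x = Sum.inl none ∧ ∃ i, y = Sum.inl (some i)) ∨
    (x = Sum.inr none ∧ ∃ j, y = Sum.inr (some j))

end SimpleGraph

/-!
*One of the two numbers is at most two.* Give an edge `xy` one colour and all other edges at `x` and
`y` the other colour: a path from a neighbour of `y` across `yx` to a neighbour of `x` then
alternates. If any two nonadjacent vertices of `G` have two common neighbours, it suffices to
colour all remaining edges like `xy`. Otherwise some edge `xy` of `G`, or of its complement,
dominates all vertices except possibly one: two vertices with at most one common neighbour in `G`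
form such an edge of the complement. Private neighbours of `y` are then joined along geodesics to
`x` that avoid `y`, whose edges are coloured by the parity of their distance to `x`. This fails only
if at least two dominated vertices are cut off from `x` by `y`; but these vertices and the remaining
dominated ones span a complete bipartite graph in the complement, which two colours can handle, and
the at most two vertices outside it are attached to it one after the other.

*The other number is at most `n - 2`.* The edges of a spanning tree can be coloured properly with as
many colours as its maximum degree, and no vertex is adjacent to all others since the complement is
connected. If `n - 2` colours are needed, some vertex `v` misses exactly one vertex `p`, and the
edges at `v` together with an edge at `p` form a spanning `T(2, n - 2)`. A further edge of `G` could
be exchanged for an edge at `v`, which would give a connected spanning subgraph of maximum degree at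
most `n - 3`. Conversely `T(2, n - 2)` needs `n - 2` colours, as paths in a tree are unique.
-/

namespace ProperConnection

open SimpleGraph

variable {V : Type*} {G : SimpleGraph V} {f : V → V → Bool} {x y : V} {S : Set V}

/-! ### Colourings with two colours -/

/-- There is a path from `x` to `y` with vertices in `S` along which the two colours of `f`
alternate, and which is trivial or starts with the colour `i`. -/
def AltReach (G : SimpleGraph V) (f : V → V → Bool) (x : V) (i : Bool) (y : V) (S : Set V) :
    Prop :=
  ∃ p : G.Walk x y, p.IsPath ∧
    ((!i) :: p.darts.map fun d => f d.fst d.snd).IsChain (· ≠ ·) ∧ ∀ z ∈ p.support, z ∈ S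

theorem AltReach.refl {i : Bool} (hx : x ∈ S) : AltReach G f x i x S :=
  ⟨.nil, by simp, by simp, by simpa using hx⟩

theorem AltReach.mono {i : Bool} {T : Set V} (h : AltReach G f x i y S) (hST : S ⊆ T) :
    AltReach G f x i y T := by
  obtain ⟨p, hpath, halt, hS⟩ := h
  exact ⟨p, hpath, halt, fun z hz => hST (hS z hz)⟩

theorem AltReach.congr {g : V → V → Bool} {i : Bool} (h : AltReach G f x i y S)
    (hfg : ∀ u ∈ S, ∀ v ∈ S, f u v = g u v) : AltReach G g x i y S := by
  obtain ⟨p, hpath, halt, hS⟩ := h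
  refine ⟨p, hpath, ?_, hS⟩
  rwa [List.map_congr_left (g := fun d => f d.fst d.snd)]
  exact fun d hd => (hfg _ (hS _ (p.dart_fst_mem_support_of_mem_darts hd)) _
    (hS _ (p.dart_snd_mem_support_of_mem_darts hd))).symm

theorem AltReach.cons {z : V} {i : Bool} (h : G.Adj x z) (hi : f x z = i) (hx : x ∉ S)
    (hz : AltReach G f z (!i) y S) : AltReach G f x i y (insert x S) := by
  obtain ⟨p, hpath, halt, hS⟩ := hz
  refine ⟨.cons h p, hpath.cons fun hxp => hx (hS _ hxp), ?_, ?_⟩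
  · rw [Bool.not_not] at halt
    simp [hi, halt]
  · simp only [Walk.support_cons, List.mem_cons, forall_eq_or_imp]
    exact ⟨Set.mem_insert _ _, fun w hw => Set.mem_insert_of_mem _ (hS w hw)⟩

/-- Some alternating path joins `x` and `y` inside `S`. -/
def AltConn (G : SimpleGraph V) (f : V → V → Bool) (x y : V) (S : Set V) : Prop :=
  ∃ i, AltReach G f x i y S

theorem AltConn.mono {T : Set V} (h : AltConn G f x y S) (hST : S ⊆ T) : AltConn G f x y T :=
  h.imp fun _ hi => hi.mono hST

theorem altConn_iff : AltConn G f x y S ↔ ∃ p : G.Walk x y, p.IsPath ∧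
    (p.darts.map fun d => f d.fst d.snd).IsChain (· ≠ ·) ∧ ∀ z ∈ p.support, z ∈ S := by
  constructor
  · rintro ⟨i, p, hpath, halt, hS⟩
    exact ⟨p, hpath, halt.tail, hS⟩
  · rintro ⟨p, hpath, halt, hS⟩
    cases p with
    | nil => exact ⟨true, .refl (hS _ (by simp))⟩
    | @cons _ z _ h p =>
      refine ⟨f x z, .cons h p, hpath, ?_, hS⟩
      simpa only [Walk.darts_cons, List.map_cons, List.isChain_cons_cons, ne_eq,
        Bool.not_eq_eq_eq_not, not_not, true_and, Bool.not_eq_not] using halt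

theorem AltConn.symm (hf : ∀ u v, f u v = f v u) (h : AltConn G f x y S) :
    AltConn G f y x S := by
  rw [altConn_iff] at h ⊢
  obtain ⟨p, hpath, halt, hS⟩ := h
  have hrev : (fun d : G.Dart => f d.fst d.snd) ∘ Dart.symm = fun d => f d.fst d.snd :=
    funext fun d => hf _ _
  refine ⟨p.reverse, hpath.reverse, ?_, by simpa using hS⟩
  rw [Walk.darts_reverse, List.map_reverse, List.map_map, List.isChain_reverse, hrev]
  exact halt.imp fun _ _ => Ne.symm

theorem AltConn.of_adj (h : G.Adj x y) (hx : x ∈ S) (hy : y ∈ S) : AltConn G f x y S :=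
  ⟨f x y, (AltReach.cons h rfl (S := {y}) h.ne (.refl rfl)).mono
    (Set.insert_subset hx (Set.singleton_subset_iff.2 hy))⟩

/-- The vertex list `x :: l` is a path of `G` on which the colours of `f` alternate, starting with
the colour `i`. -/
def IsAltList (G : SimpleGraph V) (f : V → V → Bool) : Bool → V → List V → Prop
  | _, _, [] => True
  | i, x, z :: l => G.Adj x z ∧ f x z = i ∧ x ∉ z :: l ∧ IsAltList G f (!i) z l

theorem IsAltList.altReach (l : List V) {i : Bool} (h : IsAltList G f i x l) :
    AltReach G f x i ((x :: l).getLast (by simp)) {z | z ∈ x :: l} := by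
  induction l generalizing x i with
  | nil => exact AltReach.refl (by simp)
  | cons z l ih =>
    obtain ⟨hadj, hi, hx, hl⟩ := h
    rw [List.getLast_cons (by simp)]
    exact (AltReach.cons hadj hi (S := {w | w ∈ z :: l}) hx (ih hl)).mono fun w hw => by
      simpa using hw

theorem IsAltList.altConn (l : List V) (i : Bool) (h : IsAltList G f i x l)
    (hy : (x :: l).getLast (by simp) = y) (hS : ∀ z ∈ x :: l, z ∈ S) : AltConn G f x y S :=
  ⟨i, hy ▸ h.altReach.mono hS⟩

/-- The edges of `G` have a colouring with two colours, encoded by a symmetric function `f`, for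
which any two vertices are joined by a proper path. -/
def HasAltColoring (G : SimpleGraph V) : Prop :=
  ∃ f : V → V → Bool, (∀ u v, f u v = f v u) ∧ ∀ x y, x ≠ y → AltConn G f x y Set.univ

theorem HasAltColoring.properConnectionNumber_le (h : HasAltColoring G) :
    G.properConnectionNumber ≤ 2 := by
  obtain ⟨f, hf, h⟩ := h
  refine Nat.sInf_le ⟨EdgeLabeling.mk (fun x y _ => finTwoEquiv.symm (f x y))
    (fun x y _ => by rw [hf]), fun x y hxy => ?_⟩
  obtain ⟨p, hpath, halt, -⟩ := altConn_iff.1 (h x y hxy)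
  refine ⟨p, hpath, ?_⟩
  rw [List.isChain_map] at halt ⊢
  exact halt.imp fun a b hab => finTwoEquiv.symm.injective.ne hab

/-- A colouring with two colours for which any two vertices of `S` are joined by a proper path
inside `S` and all proper paths to `w` can be chosen to end with the same colour, so that further
vertices can be attached at `w`. -/
def RootedAlt (G : SimpleGraph V) (S : Set V) (w : V) : Prop :=
  ∃ f : V → V → Bool, (∀ u v, f u v = f v u) ∧
    (∀ x ∈ S, ∀ y ∈ S, x ≠ y → AltConn G f x y S) ∧
    ∃ i, ∀ x ∈ S, x ≠ w → AltReach G f w i x S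

theorem RootedAlt.hasAltColoring {w : V} (h : RootedAlt G S w) (hS : ∀ x, x ∈ S) :
    HasAltColoring G := by
  obtain ⟨f, hf, h, -⟩ := h
  exact ⟨f, hf, fun x y hxy => (h x (hS x) y (hS y) hxy).mono (Set.subset_univ _)⟩

theorem RootedAlt.adjoin {w v : V} (h : RootedAlt G S w) (hw : w ∈ S) (hv : v ∉ S)
    (hvw : G.Adj v w) : RootedAlt G (insert v S) v := by
  classical
  obtain ⟨f, hf, hS, i, hi⟩ := h
  let g : V → V → Bool := fun a b => if a = v ∨ b = v then !i else f a b
  have hg : ∀ a b, g a b = g b a := fun a b => by simp only [g, hf a b, or_comm]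
  have hfg : ∀ a ∈ S, ∀ b ∈ S, f a b = g a b := fun a ha b hb => by
    simp [g, ne_of_mem_of_not_mem ha hv, ne_of_mem_of_not_mem hb hv]
  have hroot : ∀ x ∈ insert v S, x ≠ v → AltReach G g v (!i) x (insert v S) := by
    intro x hx hxv
    refine AltReach.cons hvw (by simp [g]) hv ?_
    rw [Bool.not_not]
    rcases eq_or_ne x w with rfl | hxw
    · exact .refl hw
    · exact (hi x (hx.resolve_left hxv) hxw).congr hfg
  refine ⟨g, hg, fun x hx y hy hxy => ?_, !i, hroot⟩
  rcases eq_or_ne x v with rfl | hxv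
  · exact ⟨_, hroot y hy hxy.symm⟩
  rcases eq_or_ne y v with rfl | hyv
  · exact AltConn.symm hg ⟨_, hroot x hx hxv⟩
  · obtain ⟨j, hj⟩ := hS x (hx.resolve_left hxv) y (hy.resolve_left hyv) hxy
    exact ⟨j, (hj.congr hfg).mono (Set.subset_insert _ _)⟩

section CompleteBipartite

variable {A B : Set V}

open Classical in
/-- The two-colouring of a complete bipartite graph in which an edge has the colour `true` if and
only if it contains exactly one of the vertices `a` and `b`. -/
noncomputable def crossColor (a b u v : V) : Bool :=
  xor (decide (u = a ∨ v = a)) (decide (u = b ∨ v = b))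

theorem crossColor_symm (a b u v : V) : crossColor a b u v = crossColor a b v u := by
  grind [crossColor]

theorem crossColor_comm (a b : V) : crossColor a b = crossColor b a := by
  funext u v
  exact Bool.xor_comm _ _

theorem altConn_crossColor_of_mem_left (hAB : ∀ a ∈ A, ∀ b ∈ B, G.Adj a b) {a b w u v : V}
    (ha : a ∈ A) (hb : b ∈ B) (hw : w ∈ B) (hwb : w ≠ b) (hu : u ∈ A) (hv : v ∈ A) (huv : u ≠ v) :
    AltConn G (crossColor a b) u v (A ∪ B) := by
  have hne : ∀ a ∈ A, ∀ b ∈ B, a ≠ b := fun a ha b hb => (hAB a ha b hb).ne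
  wlog hua : u ≠ a generalizing u v
  · exact (this hv hu huv.symm (by grind)).symm (crossColor_symm a b)
  by_cases hva : v = a
  · refine IsAltList.altConn [w, a] false ?_ (by simp [hva]) (by simp_all)
    simp only [IsAltList, crossColor, List.mem_cons, List.not_mem_nil, or_false, not_or]
    grind [Adj.symm]
  · refine IsAltList.altConn [w, a, b, v] false ?_ (by simp) (by simp_all)
    simp only [IsAltList, crossColor, List.mem_cons, List.not_mem_nil, or_false, not_or]
    grind [Adj.symm]

theorem altReach_crossColor_of_mem_right (hAB : ∀ a ∈ A, ∀ b ∈ B, G.Adj a b) {a a' b w u : V}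
    (ha : a ∈ A) (ha' : a' ∈ A) (haa' : a' ≠ a) (hb : b ∈ B) (hw : w ∈ B) (hwb : w ≠ b)
    (hu : u ∈ A ∪ B) (huw : u ≠ w) : AltReach G (crossColor a b) w false u (A ∪ B) := by
  have hne : ∀ a ∈ A, ∀ b ∈ B, a ≠ b := fun a ha b hb => (hAB a ha b hb).ne
  have of_list : ∀ l : List V, IsAltList G (crossColor a b) false w (l ++ [u]) →
      (∀ z ∈ l, z ∈ A ∪ B) → AltReach G (crossColor a b) w false u (A ∪ B) := by
    intro l hl hlS
    have h := hl.altReach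
    simp only [List.getLast_cons (List.concat_ne_nil u l), List.getLast_append_singleton] at h
    exact h.mono (by grind)
  rcases hu with hu | hu
  · by_cases hua : u = a
    · refine of_list [a', b] ?_ (by simp_all)
      simp only [IsAltList, crossColor, List.cons_append, List.nil_append, List.mem_cons,
        List.not_mem_nil, or_false, not_or]
      grind [Adj.symm]
    · refine of_list [] ?_ (by simp)
      simp only [IsAltList, crossColor, List.nil_append, List.mem_cons, List.not_mem_nil, or_false]
      grind [Adj.symm]
  · by_cases hub : u = b
    · refine of_list [a'] ?_ (by simp_all)
      simp only [IsAltList, crossColor, List.cons_append, List.nil_append, List.mem_cons,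
        List.not_mem_nil, or_false, not_or]
      grind [Adj.symm]
    · refine of_list [a', b, a] ?_ (by simp_all)
      simp only [IsAltList, crossColor, List.cons_append, List.nil_append, List.mem_cons,
        List.not_mem_nil, or_false, not_or]
      grind [Adj.symm]

theorem rootedAlt_of_complete_bipartite (hAB : ∀ a ∈ A, ∀ b ∈ B, G.Adj a b) (hA : A.Nontrivial)
    (hB : B.Nontrivial) {w : V} (hw : w ∈ A ∪ B) : RootedAlt G (A ∪ B) w := by
  wlog hwB : w ∈ B generalizing A B
  · rw [Set.union_comm] at hw ⊢
    exact this (fun b hb a ha => (hAB a ha b hb).symm) hB hA hw (hw.resolve_left hwB)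
  obtain ⟨a', ha', a, ha, haa'⟩ := hA
  obtain ⟨b, hb, hbw⟩ := hB.exists_ne w
  refine ⟨crossColor a b, crossColor_symm a b, ?_, false, fun x hx hxw =>
    altReach_crossColor_of_mem_right hAB ha ha' haa' hb hwB hbw.symm hx hxw⟩
  rintro x (hx | hx) y (hy | hy) hxy
  · exact altConn_crossColor_of_mem_left hAB ha hb hwB hbw.symm hx hy hxy
  · exact .of_adj (hAB x hx y hy) (.inl hx) (.inr hy)
  · exact .of_adj (hAB y hy x hx).symm (.inr hx) (.inl hy)
  · rw [crossColor_comm, Set.union_comm]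
    exact altConn_crossColor_of_mem_left (fun b hb a ha => (hAB a ha b hb).symm) hb ha ha' haa'
      hx hy hxy

end CompleteBipartite

section Dipole

/-- The vertices that are neither ends of the edge `xy` nor adjacent to one of its ends. -/
def undominated (G : SimpleGraph V) (x y : V) : Set V :=
  {d | d ≠ x ∧ d ≠ y ∧ ¬ G.Adj x d ∧ ¬ G.Adj y d}

/-- The neighbours of `x` that the edge `xy` dominates only through `x`. -/
def privateNeighborSet (G : SimpleGraph V) (x y : V) : Set V :=
  {a | G.Adj x a ∧ a ≠ y ∧ ¬ G.Adj y a}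

theorem undominated_comm (G : SimpleGraph V) (x y : V) : undominated G x y = undominated G y x := by
  ext d
  simp only [undominated, Set.mem_ofPred_eq]
  tauto

/-- Among the edges at `x` and `y` exactly `xy` has the colour `true`. -/
structure IsDipole (G : SimpleGraph V) (f : V → V → Bool) (x y : V) : Prop where
  adj : G.Adj x y
  symm : ∀ u v, f u v = f v u
  edge : f x y = true
  left : ∀ z, G.Adj x z → z ≠ y → f x z = false
  right : ∀ z, G.Adj y z → z ≠ x → f y z = false

namespace IsDipole

variable {u v w t d : V}

theorem swap (h : IsDipole G f x y) : IsDipole G f y x :=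
  ⟨h.adj.symm, h.symm, by rw [h.symm, h.edge], h.right, h.left⟩

theorem altConn_cross (h : IsDipole G f x y) (hu : G.Adj y u) (hux : u ≠ x) (hv : G.Adj x v)
    (hvy : v ≠ y) (huv : u ≠ v) : AltConn G f u v Set.univ := by
  refine IsAltList.altConn [y, x, v] false ?_ (by simp) (by simp)
  have := h.right u hu hux
  have := h.left v hv hvy
  simp only [IsAltList, List.mem_cons, List.not_mem_nil, or_false, not_or]
  grind [h.adj, h.edge, Adj.symm, Adj.ne, h.symm]

theorem altConn_extended (h : IsDipole G f x y) (hu : G.Adj y u) (hux : u ≠ x)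
    (hw : G.Adj x w) (hwy : w ≠ y) (huw : u ≠ w) (hwd : G.Adj w d)
    (hwd' : f w d = true) (hdx : d ≠ x) (hdy : d ≠ y) (hud : u ≠ d) : AltConn G f u d Set.univ := by
  refine IsAltList.altConn [y, x, w, d] false ?_ (by simp) (by simp)
  have := h.right u hu hux
  have := h.left w hw hwy
  simp only [IsAltList, List.mem_cons, List.not_mem_nil, or_false, not_or]
  grind [h.adj, h.edge, Adj.symm, Adj.ne, h.symm]

theorem altConn_left (h : IsDipole G f x y)
    (hx : ∀ d ∈ undominated G x y, ∃ w ∈ G.commonNeighbors x d, f w d = true) (hv : v ≠ x) :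
    AltConn G f x v Set.univ := by
  by_cases hxv : G.Adj x v
  · exact .of_adj hxv trivial trivial
  have hvy : v ≠ y := fun hvy => hxv (hvy ▸ h.adj)
  by_cases hyv : G.Adj y v
  · refine IsAltList.altConn [y, v] true ?_ (by simp) (by simp)
    simp [IsAltList, h.adj, h.edge, h.adj.ne, hv.symm, hyv, h.right v hyv hv, hvy.symm]
  · obtain ⟨w, hw, hwv⟩ := hx v ⟨hv, hvy, hxv, hyv⟩
    obtain ⟨hxw, hvw⟩ := G.mem_commonNeighbors.1 hw
    have hwy : w ≠ y := fun hwy => hyv (hwy ▸ hvw.symm)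
    refine IsAltList.altConn [w, v] false ?_ (by simp) (by simp)
    simp [IsAltList, hxw, hxw.ne, h.left w hxw hwy, hv.symm, hvw.symm, hwv, hvw.ne.symm]

theorem altConn_undominated (h : IsDipole G f x y)
    (hx : ∀ d ∈ undominated G x y, ∃ w ∈ G.commonNeighbors x d, f w d = true)
    (hu : G.Adj y u) (hux : u ≠ x) (hd : d ∈ undominated G x y) : AltConn G f u d Set.univ := by
  obtain ⟨w, hw, hwd⟩ := hx d hd
  obtain ⟨hxw, hdw⟩ := G.mem_commonNeighbors.1 hw
  rcases eq_or_ne u w with rfl | huw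
  · exact .of_adj hdw.symm trivial trivial
  · exact h.altConn_extended hu hux hxw (fun hwy => hd.2.2.2 (hwy ▸ hdw.symm)) huw hdw.symm hwd
      hd.1 hd.2.1 (fun hud => hd.2.2.2 (hud ▸ hu))

theorem altConn_of_dominated (h : IsDipole G f x y)
    (hX : (privateNeighborSet G x y).Pairwise fun u v => AltConn G f u v Set.univ)
    (hY : (privateNeighborSet G y x).Pairwise fun u v => AltConn G f u v Set.univ)
    (hux : u ≠ x) (huy : u ≠ y) (hu : G.Adj x u ∨ G.Adj y u)
    (hvx : v ≠ x) (hvy : v ≠ y) (hv : G.Adj x v ∨ G.Adj y v) (huv : u ≠ v) :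
    AltConn G f u v Set.univ := by
  by_cases hyu : G.Adj y u
  · by_cases hxv : G.Adj x v
    · exact h.altConn_cross hyu hux hxv hvy huv
    by_cases hxu : G.Adj x u
    · exact h.swap.altConn_cross hxu huy (hv.resolve_left hxv) hvx huv
    · exact hY ⟨hyu, hux, hxu⟩ ⟨hv.resolve_left hxv, hvx, hxv⟩ huv
  · have hxu := hu.resolve_right hyu
    by_cases hyv : G.Adj y v
    · exact h.swap.altConn_cross hxu huy hyv hvx huv
    · exact hX ⟨hxu, huy, hyu⟩ ⟨hv.resolve_right hyv, hvy, hyv⟩ huv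

theorem hasAltColoring (h : IsDipole G f x y)
    (hx : ∀ d ∈ undominated G x y, ∃ w ∈ G.commonNeighbors x d, f w d = true)
    (hy : ∀ d ∈ undominated G x y, ∃ w ∈ G.commonNeighbors y d, f w d = true)
    (hX : (privateNeighborSet G x y).Pairwise fun u v => AltConn G f u v Set.univ)
    (hY : (privateNeighborSet G y x).Pairwise fun u v => AltConn G f u v Set.univ)
    (hD : (undominated G x y).Pairwise fun u v => AltConn G f u v Set.univ) :
    HasAltColoring G := by
  refine ⟨f, h.symm, fun u v huv => ?_⟩
  by_cases hux : u = x
  · exact hux ▸ h.altConn_left hx (hux ▸ huv.symm)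
  by_cases huy : u = y
  · exact huy ▸ h.swap.altConn_left (undominated_comm G x y ▸ hy) (huy ▸ huv.symm)
  by_cases hvx : v = x
  · exact (hvx ▸ h.altConn_left hx hux).symm h.symm
  by_cases hvy : v = y
  · exact (hvy ▸ h.swap.altConn_left (undominated_comm G x y ▸ hy) huy).symm h.symm
  have hdom : ∀ w, w ≠ x → w ≠ y → w ∉ undominated G x y → G.Adj x w ∨ G.Adj y w :=
    fun w hwx hwy hw => by simpa [undominated, hwx, hwy, or_iff_not_imp_left] using hw
  have hmixed : ∀ w, w ≠ x → w ≠ y → w ∉ undominated G x y → ∀ d ∈ undominated G x y,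
      AltConn G f w d Set.univ := fun w hwx hwy hw d hd =>
    (hdom w hwx hwy hw).elim
      (fun hxw => h.swap.altConn_undominated (undominated_comm G x y ▸ hy) hxw hwy
        (undominated_comm G x y ▸ hd))
      (fun hyw => h.altConn_undominated hx hyw hwx hd)
  by_cases hu : u ∈ undominated G x y <;> by_cases hv : v ∈ undominated G x y
  · exact hD hu hv huv
  · exact (hmixed v hvx hvy hv u hu).symm h.symm
  · exact hmixed u hux huy hu v hv
  · exact h.altConn_of_dominated hX hY hux huy (hdom u hux huy hu) hvx hvy (hdom v hvx hvy hv) huv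

end IsDipole

end Dipole

section TwoCommonNeighbors

open Classical in
/-- The colouring of `IsDipole` in which all edges disjoint from `xy` have the colour `true`. -/
noncomputable def dipoleColor (x y u v : V) : Bool :=
  decide (u ∈ ({x, y} : Set V) ↔ v ∈ ({x, y} : Set V))

theorem dipoleColor_eq_true {u v : V} (hu : u ∉ ({x, y} : Set V)) (hv : v ∉ ({x, y} : Set V)) :
    dipoleColor x y u v = true := by
  simp [dipoleColor, hu, hv]

theorem isDipole_dipoleColor (hxy : G.Adj x y) : IsDipole G (dipoleColor x y) x y where
  adj := hxy
  symm _ _ := by simp only [dipoleColor, decide_eq_decide, iff_comm]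
  edge := by simp [dipoleColor]
  left z hz hzy := by simp [dipoleColor, hz.ne.symm, hzy]
  right z hz hzx := by simp [dipoleColor, hz.ne.symm, hzx]

theorem exists_mem_commonNeighbors_ne {u v : V} (h : (G.commonNeighbors u v).Nontrivial) (t : V) :
    ∃ w ≠ t, G.Adj u w ∧ G.Adj w v := by
  obtain ⟨w, hw, hwt⟩ := h.exists_ne t
  obtain ⟨huw, hvw⟩ := G.mem_commonNeighbors.1 hw
  exact ⟨w, hwt, huw, hvw.symm⟩

theorem dipoleColor_comm (x y : V) : dipoleColor x y = dipoleColor y x := by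
  funext u v
  exact decide_eq_decide.2 (by rw [Set.pair_comm])

variable (hxy : G.Adj x y)
  (hcom : ∀ u v, u ≠ v → ¬ G.Adj u v → (G.commonNeighbors u v).Nontrivial)

include hcom in
theorem exists_commonNeighbor_dipoleColor {d : V} (hd : d ∈ undominated G x y) :
    ∃ w ∈ G.commonNeighbors x d, dipoleColor x y w d = true := by
  obtain ⟨hdx, hdy, hxd, hyd⟩ := hd
  obtain ⟨w, hw⟩ := (hcom x d hdx.symm hxd).nonempty
  obtain ⟨hxw, hdw⟩ := G.mem_commonNeighbors.1 hw
  refine ⟨w, hw, dipoleColor_eq_true ?_ (by simp [hdx, hdy])⟩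
  rintro (rfl | rfl)
  exacts [hxw.ne rfl, hyd hdw.symm]

include hxy hcom in
theorem altConn_dipoleColor_of_private {u v : V} (hu : u ∈ privateNeighborSet G y x)
    (hv : v ∈ privateNeighborSet G y x) (huv : u ≠ v) :
    AltConn G (dipoleColor x y) u v Set.univ := by
  obtain ⟨hyu, hux, hxu⟩ := hu
  obtain ⟨hyv, hvx, hxv⟩ := hv
  obtain ⟨w, hwy, hxw, hwv⟩ := exists_mem_commonNeighbors_ne (hcom x v hvx.symm hxv) y
  exact (isDipole_dipoleColor hxy).altConn_extended hyu hux hxw hwy (fun huw => hxu (huw ▸ hxw))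
    hwv (dipoleColor_eq_true (by simp [hxw.ne.symm, hwy]) (by simp [hvx, hyv.ne.symm])) hvx
    hyv.ne.symm huv

include hxy hcom in
theorem altConn_dipoleColor_of_undominated {u v : V} (hu : u ∈ undominated G x y)
    (hv : v ∈ undominated G x y) (huv : u ≠ v) : AltConn G (dipoleColor x y) u v Set.univ := by
  have h := isDipole_dipoleColor hxy
  have hcol : ∀ w d, d ∈ undominated G x y → w ≠ x → w ≠ y → dipoleColor x y w d = true :=
    fun w d hd hwx hwy => dipoleColor_eq_true (by simp [hwx, hwy]) (by simp [hd.1, hd.2.1])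
  have ⟨hux, huy, hxu, hyu⟩ := hu
  have ⟨hvx, hvy, hxv, hyv⟩ := hv
  obtain ⟨s, hs⟩ := (hcom y u huy.symm hyu).nonempty
  obtain ⟨hys, hus⟩ := G.mem_commonNeighbors.1 hs
  obtain ⟨w, hws, hxw, hwv⟩ := exists_mem_commonNeighbors_ne (hcom x v hvx.symm hxv) s
  have hsx : s ≠ x := fun hsx => hxu (hsx ▸ hus.symm)
  have hwy : w ≠ y := fun hwy => hyv (hwy ▸ hwv)
  have hsu := hcol s u hu hsx hys.ne.symm
  have hwv' := hcol w v hv hxw.ne.symm hwy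
  have := h.right s hys hsx
  have := h.left w hxw hwy
  refine IsAltList.altConn [s, y, x, w, v] true ?_ (by simp) (by simp)
  simp only [IsAltList, List.mem_cons, List.not_mem_nil, or_false, not_or]
  grind [h.edge, Adj.symm, Adj.ne, h.symm]

include hxy hcom in
theorem hasAltColoring_of_nontrivial_commonNeighbors : HasAltColoring G := by
  refine (isDipole_dipoleColor hxy).hasAltColoring ?_ ?_ ?_ ?_ ?_
  · exact fun d hd => exists_commonNeighbor_dipoleColor hcom hd
  · rw [dipoleColor_comm, undominated_comm]
    exact fun d hd => exists_commonNeighbor_dipoleColor hcom hd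
  · rw [dipoleColor_comm]
    exact fun u hu v hv => altConn_dipoleColor_of_private hxy.symm hcom hu hv
  · exact fun u hu v hv => altConn_dipoleColor_of_private hxy hcom hu hv
  · exact fun u hu v hv => altConn_dipoleColor_of_undominated hxy hcom hu hv

end TwoCommonNeighbors

section AlmostDominatingEdge

theorem exists_adj_dist_eq_add_one {K : SimpleGraph V} {v : V} (h : K.Reachable v x) (hv : v ≠ x) :
    ∃ u, K.Adj v u ∧ K.dist v x = K.dist u x + 1 := by
  obtain ⟨p, hp⟩ := h.exists_walk_length_eq_dist
  cases p with
  | nil => exact (hv rfl).elim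
  | @cons _ u _ hvu q =>
    have hq := dist_le q
    have htri : K.dist v x ≤ K.dist v u + K.dist u x := hvu.reachable.dist_triangle_left x
    rw [dist_eq_one_iff_adj.2 hvu] at htri
    rw [Walk.length_cons] at hp
    exact ⟨u, hvu, by omega⟩

/-- Distances to `x` drop by one along a geodesic of `K`, so their parities alternate; its last edge
has the colour `false`, so the path can continue across `xy`. -/
theorem IsDipole.altReach_of_dist (h : IsDipole G f x y) {K : SimpleGraph V} (hK : K ≤ G)
    (hy : ∀ z, ¬ K.Adj z y)
    (hf : ∀ v u, K.Adj v u → K.dist v x = K.dist u x + 1 → f v u = decide (Even (K.dist v x)))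
    {b v : V} (hb : G.Adj y b) (hv : K.Reachable v x) (hvb : v ≠ b)
    (hle : K.Reachable b x → K.dist v x ≤ K.dist b x) :
    AltReach G f v (decide (Even (K.dist v x))) b
      ({y, b} ∪ {z | K.Reachable z x ∧ K.dist z x ≤ K.dist v x}) := by
  induction hk : K.dist v x generalizing v with
  | zero =>
    obtain rfl := hv.dist_eq_zero_iff.1 hk
    refine (IsAltList.altReach [y, b] (i := true) ?_).mono ?_
    · simp [IsAltList, h.adj, h.edge, h.adj.ne, hb, hb.ne, hvb, h.right b hb hvb.symm]
    · rintro z hz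
      simp only [List.mem_cons, List.not_mem_nil, or_false, Set.mem_ofPred_eq] at hz
      rcases hz with rfl | rfl | rfl <;> simp
  | succ k ih =>
    have hvx : v ≠ x := by
      rintro rfl
      simp at hk
    obtain ⟨u, hvu, hvu'⟩ := exists_adj_dist_eq_add_one hv hvx
    have huk : K.dist u x = k := by omega
    have hub : u ≠ b := by
      rintro rfl
      have := hle (hvu.symm.reachable.trans hv)
      omega
    have hu := ih (hvu.symm.reachable.trans hv) hub (fun hbx => by have := hle hbx; omega) huk
    refine (AltReach.cons (hK hvu) ((hf v u hvu hvu').trans (by rw [hk])) ?_ ?_).mono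
      (S := insert v ({y, b} ∪ {z | K.Reachable z x ∧ K.dist z x ≤ k})) ?_
    · rintro ((rfl | hvb') | ⟨-, hvk⟩)
      · exact hy u hvu.symm
      · exact hvb hvb'
      · omega
    · simpa [Nat.even_add_one, -Nat.not_even_iff_odd] using hu
    · refine Set.insert_subset (.inr ⟨hv, hk.le⟩) (Set.union_subset_union_right _ ?_)
      exact fun z hz => ⟨hz.1, by have := hz.2; omega⟩

/-- The vertices other than `y` that are dominated by the edge `xy`. -/
def side (G : SimpleGraph V) (x y : V) : Set V :=
  {v | v ≠ y ∧ (v = x ∨ G.Adj x v ∨ G.Adj y v)}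

/-- The edges of `G` between the vertices of `side G x y`. Distances to `x` in this graph determine
the colours of the edges between private neighbours of `y`. -/
def sideGraph (G : SimpleGraph V) (x y : V) : SimpleGraph V :=
  ((⊤ : G.Subgraph).induce (side G x y)).spanningCoe

/-- The vertices of `side G x y` that have no level because every path to `x` leaves this set. -/
def unlevelled (G : SimpleGraph V) (x y : V) : Set V :=
  {v ∈ side G x y | ¬ (sideGraph G x y).Reachable v x}

open Classical in
/-- The parity colouring of the edges between private neighbours of `y`; all other edges have
the colour `true`. -/
noncomputable def levelColor (G : SimpleGraph V) (x y u v : V) : Bool :=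
  decide (u ∈ privateNeighborSet G y x → v ∈ privateNeighborSet G y x →
    Even (max ((sideGraph G x y).dist u x) ((sideGraph G x y).dist v x)))

/-- The dipole colouring refined on the private neighbours of both ends of `xy`. -/
noncomputable def refinedColor (G : SimpleGraph V) (x y u v : V) : Bool :=
  dipoleColor x y u v && (levelColor G x y u v && levelColor G y x u v)

theorem sideGraph_adj {u v : V} : (sideGraph G x y).Adj u v ↔
    u ∈ side G x y ∧ v ∈ side G x y ∧ G.Adj u v := Iff.rfl

theorem levelColor_symm (G : SimpleGraph V) (x y u v : V) :
    levelColor G x y u v = levelColor G x y v u := by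
  simp only [levelColor, decide_eq_decide, max_comm ((sideGraph G x y).dist u x)]
  tauto

theorem levelColor_eq_true_of_notMem {u v : V} (hu : u ∉ privateNeighborSet G y x) :
    levelColor G x y u v = true := by
  simp [levelColor, hu]

theorem refinedColor_comm (G : SimpleGraph V) (x y : V) :
    refinedColor G x y = refinedColor G y x := by
  funext u v
  rw [refinedColor, refinedColor, dipoleColor_comm, Bool.and_comm (levelColor G x y u v)]

theorem isDipole_refinedColor (hxy : G.Adj x y) : IsDipole G (refinedColor G x y) x y := by
  have h := isDipole_dipoleColor hxy
  refine ⟨hxy, fun u v => ?_, ?_, fun z hz hzy => ?_, fun z hz hzx => ?_⟩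
  · rw [refinedColor, h.symm, levelColor_symm, levelColor_symm G y x, refinedColor]
  · have hx : x ∉ privateNeighborSet G y x := fun hx => hx.2.1 rfl
    have hx' : x ∉ privateNeighborSet G x y := fun hx => hx.1.ne rfl
    rw [refinedColor, h.edge, levelColor_eq_true_of_notMem hx, levelColor_eq_true_of_notMem hx',
      Bool.and_self, Bool.and_self]
  · rw [refinedColor, h.left z hz hzy, Bool.false_and]
  · rw [refinedColor, h.right z hz hzx, Bool.false_and]

theorem refinedColor_eq_even_dist (hxy : G.Adj x y) {u v : V} (hvu : (sideGraph G x y).Adj v u)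
    (hdist : (sideGraph G x y).dist v x = (sideGraph G x y).dist u x + 1) :
    refinedColor G x y v u = decide (Even ((sideGraph G x y).dist v x)) := by
  obtain ⟨⟨hvy, hv⟩, ⟨huy, hu⟩, hvu'⟩ := sideGraph_adj.1 hvu
  have hvx : v ≠ x := by
    rintro rfl
    simp at hdist
  have hxs : x ∈ side G x y := ⟨hxy.ne, .inl rfl⟩
  have dist_one : ∀ w ∈ side G x y, G.Adj x w → (sideGraph G x y).dist w x = 1 := fun w hw hxw =>
    dist_eq_one_iff_adj.2 (sideGraph_adj.2 ⟨hw, hxs, hxw.symm⟩)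
  by_cases hxv : G.Adj x v
  · have hv1 := dist_one v ⟨hvy, hv⟩ hxv
    have hreach : (sideGraph G x y).Reachable u x :=
      hvu.symm.reachable.trans (sideGraph_adj.2 ⟨⟨hvy, hv⟩, hxs, hxv.symm⟩).reachable
    obtain rfl := hreach.dist_eq_zero_iff.1 (by omega)
    rw [hv1, (isDipole_refinedColor hxy).symm, (isDipole_refinedColor hxy).left v hxv hvy]
    simp
  have hux : u ≠ x := fun hux => hxv (hux ▸ hvu'.symm)
  have hyv : G.Adj y v := (hv.resolve_left hvx).resolve_left hxv
  have hbase : dipoleColor x y v u = true :=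
    dipoleColor_eq_true (by simp [hvx, hvy]) (by simp [hux, huy])
  have hvB : v ∉ privateNeighborSet G x y := fun hvB => hxv hvB.1
  rw [refinedColor, hbase, levelColor_eq_true_of_notMem hvB, Bool.and_true, Bool.true_and]
  by_cases hxu : G.Adj x u
  · have huA : u ∉ privateNeighborSet G y x := fun huA => huA.2.2 hxu
    rw [levelColor_symm, levelColor_eq_true_of_notMem huA, hdist, dist_one u ⟨huy, hu⟩ hxu]
    simp
  · have hvA : v ∈ privateNeighborSet G y x := ⟨hyv, hvx, hxv⟩
    have huA : u ∈ privateNeighborSet G y x :=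
      ⟨(hu.resolve_left hux).resolve_left hxu, hux, hxu⟩
    have hle : (sideGraph G x y).dist u x ≤ (sideGraph G x y).dist v x := by omega
    simp only [levelColor, hvA, huA, true_imp_iff, max_eq_left hle]

theorem altConn_refinedColor_of_private (hxy : G.Adj x y) (h : (unlevelled G x y).Subsingleton)
    {u v : V} (hu : u ∈ privateNeighborSet G y x) (hv : v ∈ privateNeighborSet G y x)
    (huv : u ≠ v) : AltConn G (refinedColor G x y) u v Set.univ := by
  have hside : ∀ w ∈ privateNeighborSet G y x, w ∈ side G x y :=
    fun w hw => ⟨hw.1.ne.symm, .inr (.inr hw.1)⟩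
  wlog hle : (sideGraph G x y).Reachable u x ∧ ((sideGraph G x y).Reachable v x →
      (sideGraph G x y).dist u x ≤ (sideGraph G x y).dist v x) generalizing u v
  · refine (this hv hu huv.symm ?_).symm (isDipole_refinedColor hxy).symm
    by_cases hur : (sideGraph G x y).Reachable u x
    · push Not at hle
      exact ⟨(hle hur).1, fun _ => (hle hur).2.le⟩
    · exact ⟨by_contra fun hvr => huv (h ⟨hside u hu, hur⟩ ⟨hside v hv, hvr⟩),
        fun h => (hur h).elim⟩
  refine ⟨_, ((isDipole_refinedColor hxy).altReach_of_dist (Subgraph.spanningCoe_le _) ?_ ?_ hv.1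
    hle.1 huv hle.2).mono (Set.subset_univ _)⟩
  · exact fun z hz => (sideGraph_adj.1 hz).2.1.1 rfl
  · exact fun w z hwz hdist => refinedColor_eq_even_dist hxy hwz hdist

theorem exists_commonNeighbor_refinedColor {d : V} (hd : d ∈ undominated G x y)
    (hxd : (G.commonNeighbors x d).Nonempty) :
    ∃ w ∈ G.commonNeighbors x d, refinedColor G x y w d = true := by
  obtain ⟨hdx, hdy, hxd', hyd⟩ := hd
  obtain ⟨w, hw⟩ := hxd
  obtain ⟨hxw, hdw⟩ := G.mem_commonNeighbors.1 hw
  have hwy : w ≠ y := fun hwy => hyd (hwy ▸ hdw.symm)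
  have hdA : d ∉ privateNeighborSet G y x := fun hdA => hyd hdA.1
  have hdB : d ∉ privateNeighborSet G x y := fun hdB => hxd' hdB.1
  refine ⟨w, hw, ?_⟩
  rw [refinedColor, dipoleColor_eq_true (by simp [hxw.ne.symm, hwy]) (by simp [hdx, hdy]),
    levelColor_symm, levelColor_eq_true_of_notMem hdA, levelColor_symm,
    levelColor_eq_true_of_notMem hdB, Bool.and_self, Bool.and_self]

variable (hxy : G.Adj x y) (hsub : (undominated G x y).Subsingleton)
  (hx : ∀ d ∈ undominated G x y, (G.commonNeighbors x d).Nonempty)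
  (hy : ∀ d ∈ undominated G x y, (G.commonNeighbors y d).Nonempty)

include hxy hsub hx hy in
theorem hasAltColoring_of_subsingleton_unlevelled (hX : (unlevelled G x y).Subsingleton)
    (hY : (unlevelled G y x).Subsingleton) : HasAltColoring G := by
  refine (isDipole_refinedColor hxy).hasAltColoring ?_ ?_ ?_ ?_ (hsub.pairwise _)
  · exact fun d hd => exists_commonNeighbor_refinedColor hd (hx d hd)
  · rw [refinedColor_comm]
    exact fun d hd => exists_commonNeighbor_refinedColor (undominated_comm G x y ▸ hd) (hy d hd)
  · rw [refinedColor_comm]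
    exact fun u hu v hv => altConn_refinedColor_of_private hxy.symm hY hu hv
  · exact fun u hu v hv => altConn_refinedColor_of_private hxy hX hu hv

theorem exists_adj_mem_notMem (hG : G.Preconnected) (hx : x ∈ S) (hy : y ∉ S) :
    ∃ a ∈ S, ∃ b, b ∉ S ∧ G.Adj a b := by
  obtain ⟨p⟩ := hG x y
  obtain ⟨d, -, hfst, hsnd⟩ := p.exists_boundary_dart S hx hy
  exact ⟨_, hfst, _, hsnd, d.adj⟩

theorem mem_side_or_eq_or_mem_undominated (G : SimpleGraph V) (x y z : V) :
    z ∈ side G x y ∨ z = y ∨ z ∈ undominated G x y := by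
  simp only [side, undominated, Set.mem_ofPred_eq]
  tauto

include hxy hx in
theorem levelled_nontrivial (hGc : Gᶜ.Preconnected) :
    (side G x y \ unlevelled G x y).Nontrivial := by
  have hxs : x ∈ side G x y := ⟨hxy.ne, .inl rfl⟩
  have hxR : x ∈ side G x y \ unlevelled G x y := ⟨hxs, fun h => h.2 .rfl⟩
  by_contra hR
  rw [Set.not_nontrivial_iff] at hR
  have hleaf : ∀ w, G.Adj x w → w = y := fun w hxw => by_contra fun hwy => by
    have hw : w ∈ side G x y := ⟨hwy, .inr (.inl hxw)⟩
    exact hxw.ne (hR hxR ⟨hw, fun h => h.2 (sideGraph_adj.2 ⟨hw, hxs, hxw.symm⟩).reachable⟩)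
  obtain ⟨y', rfl, b, hby, hyb⟩ := exists_adj_mem_notMem hGc (Set.mem_singleton y) hxy.ne
  obtain ⟨-, hyb⟩ := (compl_adj _ _ _).1 hyb
  rcases mem_side_or_eq_or_mem_undominated G x y' b with ⟨-, rfl | hxb | hyb'⟩ | hb | hb
  · exact hyb hxy.symm
  · exact hby (hleaf b hxb)
  · exact hyb hyb'
  · exact hby hb
  · obtain ⟨w, hw⟩ := hx b hb
    obtain ⟨hxw, hbw⟩ := G.mem_commonNeighbors.1 hw
    exact hyb (hleaf w hxw ▸ hbw.symm)

include hxy hsub in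
theorem hasAltColoring_compl_of_rootedAlt_side (hGc : Gᶜ.Preconnected)
    (hroot : ∀ w ∈ side G x y, RootedAlt Gᶜ (side G x y) w) : HasAltColoring Gᶜ := by
  have hxs : x ∈ side G x y := ⟨hxy.ne, .inl rfl⟩
  have hys : y ∉ side G x y := fun h => h.1 rfl
  have hcases := mem_side_or_eq_or_mem_undominated G x y
  rcases (undominated G x y).eq_empty_or_nonempty with hD | ⟨d, hd⟩
  · simp only [hD, Set.mem_empty_iff_false, or_false] at hcases
    obtain ⟨y', rfl, b, hby, hyb⟩ := exists_adj_mem_notMem hGc (Set.mem_singleton y) hxy.ne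
    have hb := (hcases b).resolve_right hby
    exact ((hroot b hb).adjoin hb hys hyb).hasAltColoring fun z => (hcases z).symm
  · have ⟨hdx, hdy, hxd, hyd⟩ := hd
    have hds : d ∉ side G x y := fun h => (h.2.resolve_left hdx).elim hxd hyd
    have hdx' : Gᶜ.Adj d x := (compl_adj _ _ _).2 ⟨hdx, fun h => hxd h.symm⟩
    have hyd' : Gᶜ.Adj y d := (compl_adj _ _ _).2 ⟨hdy.symm, hyd⟩
    have hy' : y ∉ insert d (side G x y) := fun h => h.elim hdy.symm hys
    refine (((hroot x hxs).adjoin hxs hds hdx').adjoin (Set.mem_insert _ _) hy'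
      hyd').hasAltColoring fun z => ?_
    rcases hcases z with hz | hz | hz
    exacts [.inr (.inr hz), .inl hz, .inr (.inl (hsub hz hd))]

include hxy hsub hx in
theorem hasAltColoring_compl_of_nontrivial_unlevelled (hGc : Gᶜ.Preconnected)
    (hU : (unlevelled G x y).Nontrivial) : HasAltColoring Gᶜ := by
  have hunion : unlevelled G x y ∪ side G x y \ unlevelled G x y = side G x y :=
    Set.union_sdiff_cancel (Set.sep_subset _ _)
  refine hasAltColoring_compl_of_rootedAlt_side hxy hsub hGc fun w hw => ?_
  rw [← hunion] at hw ⊢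
  refine rootedAlt_of_complete_bipartite (fun a ha b hb => (compl_adj _ _ _).2 ⟨?_, fun hab => ?_⟩)
    hU (levelled_nontrivial hxy hx hGc) hw
  · exact ne_of_mem_of_not_mem ha hb.2
  · have hbx : (sideGraph G x y).Reachable b x := by_contra fun h => hb.2 ⟨hb.1, h⟩
    exact ha.2 ((sideGraph_adj.2 ⟨ha.1, hb.1, hab⟩).reachable.trans hbx)

include hxy hsub hx hy in
theorem hasAltColoring_or_compl_of_almost_dominating (hGc : Gᶜ.Preconnected) :
    HasAltColoring G ∨ HasAltColoring Gᶜ := by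
  rcases (unlevelled G x y).subsingleton_or_nontrivial with hX | hX
  · rcases (unlevelled G y x).subsingleton_or_nontrivial with hY | hY
    · exact .inl (hasAltColoring_of_subsingleton_unlevelled hxy hsub hx hy hX hY)
    · rw [undominated_comm] at hsub hy
      exact .inr (hasAltColoring_compl_of_nontrivial_unlevelled hxy.symm hsub hy hGc hY)
  · exact .inr (hasAltColoring_compl_of_nontrivial_unlevelled hxy hsub hx hGc hX)

end AlmostDominatingEdge

theorem undominated_compl (G : SimpleGraph V) (u v : V) :
    undominated Gᶜ u v = G.commonNeighbors u v := by
  ext w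
  simp only [undominated, Set.mem_ofPred_eq, compl_adj, mem_commonNeighbors]
  grind [Adj.symm, Adj.ne]

theorem hasAltColoring_or_hasAltColoring_compl [Nontrivial V] (hG : G.Connected)
    (hGc : Gᶜ.Connected) : HasAltColoring G ∨ HasAltColoring Gᶜ := by
  by_cases hdom : ∃ x y, G.Adj x y ∧ undominated G x y = ∅
  · obtain ⟨x, y, hxy, hD⟩ := hdom
    exact hasAltColoring_or_compl_of_almost_dominating hxy (by simp [hD]) (by simp [hD])
      (by simp [hD]) hGc.preconnected
  have hcom : ∀ u v, ∀ d ∈ undominated Gᶜ u v, (Gᶜ.commonNeighbors u d).Nonempty := by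
    intro u v d ⟨hdu, _, hud, _⟩
    rw [← undominated_compl, compl_compl]
    rw [compl_adj, not_and, not_not] at hud
    exact Set.nonempty_iff_ne_empty.2 fun h => hdom ⟨u, d, hud hdu.symm, h⟩
  by_cases hone : ∃ u v, Gᶜ.Adj u v ∧ (G.commonNeighbors u v).Subsingleton
  · obtain ⟨u, v, huv, hD⟩ := hone
    rw [← undominated_compl] at hD
    have := hasAltColoring_or_compl_of_almost_dominating huv hD (hcom u v)
      (undominated_comm Gᶜ u v ▸ hcom v u) (by rw [compl_compl]; exact hG.preconnected)
    rw [compl_compl] at this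
    exact this.symm
  · obtain ⟨x, y, hxy⟩ := exists_pair_ne V
    obtain ⟨a, -, b, -, hab⟩ := exists_adj_mem_notMem hG.preconnected (Set.mem_singleton x) hxy.symm
    refine .inl (hasAltColoring_of_nontrivial_commonNeighbors hab fun u v huv hadj => ?_)
    exact Set.not_subsingleton_iff.1 fun h => hone ⟨u, v, (compl_adj _ _ _).2 ⟨huv, hadj⟩, h⟩

/-! ### Proper edge colourings of spanning trees -/

/-- Any two edges with a common end have different colours. The colouring is defined on all of
`Sym2 V`, with junk values outside the edges. -/
def IsProperEdgeColoring {K : Type*} (G : SimpleGraph V) (f : Sym2 V → K) : Prop :=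
  ∀ a, Set.InjOn (fun b => f s(a, b)) (G.neighborSet a)

section IsProperEdgeColoring

variable {K : Type*} {f : Sym2 V → K} {a b : V}

theorem IsProperEdgeColoring.exists_permute_component (hf : IsProperEdgeColoring G f)
    (σ : Equiv.Perm K) (b : V) : ∃ g : Sym2 V → K, IsProperEdgeColoring G g ∧
      (∀ x y, G.Adj x y → G.Reachable x b → g s(x, y) = σ (f s(x, y))) ∧
      ∀ x y, G.Adj x y → ¬ G.Reachable x b → g s(x, y) = f s(x, y) := by
  classical
  let g : Sym2 V → K := fun e => if ∃ z ∈ e, G.Reachable z b then σ (f e) else f e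
  have hmem {x y : V} (h : G.Adj x y) : (∃ z ∈ s(x, y), G.Reachable z b) ↔ G.Reachable x b := by
    simp only [Sym2.mem_iff, exists_eq_or_imp, exists_eq_left, or_iff_left_iff_imp]
    exact h.reachable.trans
  have hin : ∀ x y, G.Adj x y → G.Reachable x b → g s(x, y) = σ (f s(x, y)) :=
    fun x y h hx => if_pos ((hmem h).2 hx)
  have hout : ∀ x y, G.Adj x y → ¬ G.Reachable x b → g s(x, y) = f s(x, y) :=
    fun x y h hx => if_neg (mt (hmem h).1 hx)
  refine ⟨g, fun x y hy z hz hyz => hf x hy hz ?_, hin, hout⟩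
  by_cases hx : G.Reachable x b
  · exact σ.injective ((hin x y hy hx).symm.trans (hyz.trans (hin x z hz hx)))
  · exact (hout x y hy hx).symm.trans (hyz.trans (hout x z hz hx))

theorem IsProperEdgeColoring.exists_sup_edge {i : K} (hf : IsProperEdgeColoring G f)
    (ha : ∀ z, G.Adj a z → f s(a, z) ≠ i) (hb : ∀ z, G.Adj b z → f s(b, z) ≠ i) :
    ∃ g : Sym2 V → K, IsProperEdgeColoring (G ⊔ edge a b) g := by
  classical
  have hmiss : ∀ x y z, G.Adj x y → s(x, z) = s(a, b) → f s(x, y) ≠ i := by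
    intro x y z hxy hxz
    obtain ⟨rfl, -⟩ | ⟨rfl, -⟩ := Sym2.eq_iff.1 hxz
    exacts [ha y hxy, hb y hxy]
  have hadj : ∀ x y, (G ⊔ edge a b).Adj x y → s(x, y) ≠ s(a, b) → G.Adj x y := by
    intro x y hxy hne
    rw [sup_adj, adj_edge] at hxy
    exact hxy.resolve_right fun h => hne h.1.symm
  refine ⟨Function.update f s(a, b) i, fun x y hy z hz hyz => ?_⟩
  by_cases h₁ : s(x, y) = s(a, b) <;> by_cases h₂ : s(x, z) = s(a, b)
  · exact Sym2.congr_right.1 (h₁.trans h₂.symm)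
  · simp only [h₁, Function.update_self, Function.update_of_ne h₂] at hyz
    exact (hmiss x z y (hadj x z hz h₂) h₁ hyz.symm).elim
  · simp only [h₂, Function.update_self, Function.update_of_ne h₁] at hyz
    exact (hmiss x y z (hadj x y hy h₁) h₂ hyz).elim
  · simp only [Function.update_of_ne h₁, Function.update_of_ne h₂] at hyz
    exact hf x (hadj x y hy h₁) (hadj x z hz h₂) hyz

theorem IsProperEdgeColoring.exists_sup_edge_of_not_reachable {i j : K}
    (hf : IsProperEdgeColoring G f) (hab : ¬ G.Reachable a b)
    (ha : ∀ z, G.Adj a z → f s(a, z) ≠ i) (hb : ∀ z, G.Adj b z → f s(b, z) ≠ j) :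
    ∃ g : Sym2 V → K, IsProperEdgeColoring (G ⊔ edge a b) g := by
  classical
  obtain ⟨g, hg, hin, hout⟩ := hf.exists_permute_component (Equiv.swap i j) b
  refine hg.exists_sup_edge (i := i) (fun z hz => ?_) fun z hz => ?_
  · rw [hout a z hz hab]
    exact ha z hz
  · rw [hin b z hz .rfl, Ne, Equiv.swap_apply_eq_iff, Equiv.swap_apply_left]
    exact hb z hz

end IsProperEdgeColoring

theorem exists_forall_adj_ne_of_ncard_lt [Finite V] {k : ℕ} {a : V} (f : Sym2 V → Fin k)
    (h : (G.neighborSet a).ncard < k) : ∃ i, ∀ z, G.Adj a z → f s(a, z) ≠ i := by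
  by_contra! hsurj
  have himg : (fun z => f s(a, z)) '' G.neighborSet a = Set.univ := Set.eq_univ_of_forall hsurj
  have hle := Set.ncard_image_le (f := fun z => f s(a, z)) (Set.toFinite (G.neighborSet a))
  rw [himg, Set.ncard_univ, Nat.card_eq_fintype_card, Fintype.card_fin] at hle
  omega

theorem exists_isProperEdgeColoring_of_isAcyclic [Finite V] {k : ℕ} (hG : G.IsAcyclic)
    (hk : 0 < k) (hdeg : ∀ v, (G.neighborSet v).ncard ≤ k) :
    ∃ f : Sym2 V → Fin k, IsProperEdgeColoring G f := by
  induction G using WellFoundedLT.induction with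
  | ind G ih =>
    obtain rfl | hne := eq_or_ne G ⊥
    · exact ⟨fun _ => ⟨0, hk⟩, fun a b hb => by simp at hb⟩
    obtain ⟨a, b, hab⟩ := ne_bot_iff_exists_adj.1 hne
    set H := G \ edge a b
    have hle : H ≤ G := sdiff_le
    have hHab : ¬ H.Reachable a b := isAcyclic_iff_forall_adj_isBridge.1 hG hab
    have hlt {x y : V} (hxy : G.Adj x y) (h : ¬ H.Adj x y) : (H.neighborSet x).ncard < k := by
      have hss : H.neighborSet x ⊂ G.neighborSet x :=
        (Set.ssubset_iff_of_subset fun z hz => hle hz).2 ⟨y, hxy, h⟩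
      exact (Set.ncard_lt_ncard hss).trans_le (hdeg x)
    have hab' : ¬ H.Adj a b := fun h => hHab h.reachable
    obtain ⟨f, hf⟩ := ih H (lt_of_le_of_ne hle fun h => hab' (h ▸ hab)) (hG.anti hle)
      fun v => (Set.ncard_le_ncard fun z hz => hle hz).trans (hdeg v)
    obtain ⟨i, hi⟩ := exists_forall_adj_ne_of_ncard_lt f (hlt hab hab')
    obtain ⟨j, hj⟩ := exists_forall_adj_ne_of_ncard_lt f (hlt hab.symm fun h => hab' h.symm)
    rw [← sdiff_sup_cancel ((edge_le_iff G).2 (.inr hab))]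
    exact hf.exists_sup_edge_of_not_reachable hHab hi hj

theorem IsProperEdgeColoring.isChain_edges {K : Type*} {f : Sym2 V → K} {p : G.Walk x y}
    (hf : IsProperEdgeColoring G f) (hp : p.IsPath) : (p.edges.map f).IsChain (· ≠ ·) := by
  induction p with
  | nil => simp
  | @cons a b _ h p ih =>
    cases p with
    | nil => simp
    | @cons _ c _ h' p =>
      obtain ⟨hp, ha⟩ := (Walk.cons_isPath_iff _ _).1 hp
      have hac : a ≠ c := fun hac => ha (by simp [hac])
      simp only [Walk.edges_cons, List.map_cons, List.isChain_cons_cons] at ih ⊢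
      refine ⟨fun hcol => hac (hf b h.symm h' ?_), ih hp⟩
      rwa [Sym2.eq_swap (a := a)] at hcol

theorem properConnectionNumber_le_of_degree_le [Finite V] {F : SimpleGraph V} {k : ℕ}
    (hFG : F ≤ G) (hF : F.Connected) (hk : 0 < k) (hdeg : ∀ v, (F.neighborSet v).ncard ≤ k) :
    G.properConnectionNumber ≤ k := by
  obtain ⟨T, hTF, hT⟩ := hF.exists_isTree_le
  obtain ⟨f, hf⟩ := exists_isProperEdgeColoring_of_isAcyclic hT.isAcyclic hk
    fun v => (Set.ncard_le_ncard fun z hz => hTF hz).trans (hdeg v)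
  refine Nat.sInf_le ⟨EdgeLabeling.mk (fun x y _ => f s(x, y))
    (fun x y _ => by rw [Sym2.eq_swap]), fun x y _ => ?_⟩
  obtain ⟨p, hp⟩ := hT.connected.exists_isPath x y
  refine ⟨p.mapLe (hTF.trans hFG), hp.mapLe _, ?_⟩
  have hchain := hf.isChain_edges hp
  rw [← Walk.edges_mapLe_eq_edges (hTF.trans hFG), Walk.edges, List.map_map] at hchain
  exact hchain

theorem exists_coloring_properConnectionNumber [Finite V] (hG : G.Connected) :
    ∃ c : G.EdgeLabeling (Fin G.properConnectionNumber), c.IsProperPathColoring :=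
  Nat.sInf_mem (exists_isProperPathColoring hG)

theorem two_le_properConnectionNumber [Finite V] (hG : G.Connected) (hxy : x ≠ y)
    (hadj : ¬ G.Adj x y) : 2 ≤ G.properConnectionNumber := by
  obtain ⟨c, hc⟩ := exists_coloring_properConnectionNumber hG
  obtain ⟨p, -, hchain⟩ := hc x y hxy
  cases p with
  | nil => exact (hxy rfl).elim
  | cons _ p =>
    cases p with
    | nil => contradiction
    | cons _ p =>
      simp only [Walk.darts_cons, List.map_cons, List.isChain_cons_cons] at hchain
      by_contra! hlt
      have : Subsingleton (Fin G.properConnectionNumber) :=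
        Fin.subsingleton_iff_le_one.2 (Nat.le_of_lt_succ hlt)
      exact hchain.1 (Subsingleton.elim _ _)

theorem get_ne_get_of_isAcyclic {K : Type*} {c : G.EdgeLabeling K} {v : V} (hG : G.IsAcyclic)
    (hc : c.IsProperPathColoring) (hx : G.Adj v x) (hy : G.Adj v y) (hxy : x ≠ y) :
    c.get v x hx ≠ c.get v y hy := by
  obtain ⟨q, hq, hchain⟩ := hc x y hxy
  have hp : (Walk.cons hx.symm (.cons hy .nil)).IsPath := by
    simp [hx.ne.symm, hy.ne, hxy]
  obtain rfl : q = _ :=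
    congrArg Subtype.val ((hG.subsingleton_path x y).elim ⟨q, hq⟩ ⟨_, hp⟩)
  rw [c.get_comm]
  simpa using hchain

theorem ncard_neighborSet_le_properConnectionNumber [Finite V] (hG : G.IsTree) (v : V) :
    (G.neighborSet v).ncard ≤ G.properConnectionNumber := by
  obtain ⟨c, hc⟩ := exists_coloring_properConnectionNumber hG.connected
  have hinj : Function.Injective fun x : G.neighborSet v => c.get v x x.2 := by
    rintro ⟨x, hx⟩ ⟨y, hy⟩ hxy
    by_contra hne
    exact get_ne_get_of_isAcyclic hG.isAcyclic hc hx hy (fun h => hne (Subtype.ext h)) hxy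
  simpa only [Nat.card_coe_set_eq, Nat.card_fin] using Nat.card_le_card_of_injective _ hinj

/-! ### Spanning double stars -/

/-- The spanning double star with adjacent centres `v` and `u` in which `p` is the only leaf at `u`,
for distinct `v`, `u`, `p`: the star at `v` with the leaf `p` moved to `u`. -/
def broom (v u p : V) : SimpleGraph V :=
  (starGraph v \ edge v p) ⊔ edge u p

section broom

variable {v u p : V}

theorem broom_adj : (broom v u p).Adj x y ↔
    x ≠ y ∧ ((x = v ∧ y ≠ p) ∨ (y = v ∧ x ≠ p) ∨ (x = u ∧ y = p) ∨ (x = p ∧ y = u)) := by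
  simp only [broom, sup_adj, sdiff_adj, starGraph_adj, edge_adj]
  grind

theorem isAcyclic_broom (hvp : v ≠ p) (hup : u ≠ p) : (broom v u p).IsAcyclic := by
  refine IsAcyclic.sup_edge_of_not_reachable (fun h => ?_) ((isAcyclic_starGraph v).anti sdiff_le)
  obtain ⟨q⟩ := h.symm
  have hadj := q.adj_snd (Walk.not_nil_of_ne hup.symm)
  rw [sdiff_adj, starGraph_adj, edge_adj] at hadj
  grind

theorem neighborSet_broom (hvu : v ≠ u) (hvp : v ≠ p) :
    (broom v u p).neighborSet v = {v, p}ᶜ := by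
  ext z
  simp only [mem_neighborSet, broom_adj, Set.mem_compl_iff, Set.mem_insert_iff,
    Set.mem_singleton_iff]
  grind

theorem comap_broom {W : Type*} (e : V ≃ W) (a b c : W) :
    (broom a b c).comap e = broom (e.symm a) (e.symm b) (e.symm c) := by
  ext x y
  simp [broom_adj, Equiv.eq_symm_apply]

theorem doubleStar_two_eq_broom (m : ℕ) :
    doubleStar 2 m = broom (Sum.inr none) (Sum.inl none) (Sum.inl (some 0)) := by
  ext ((_ | i) | (_ | i)) ((_ | j) | (_ | j)) <;>
    simp [doubleStar, broom_adj, Fin.fin_one_eq_zero]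

theorem exists_equiv_forall_apply_eq {ι W : Type*} [Finite ι] [Fintype V] [Fintype W]
    (hVW : Fintype.card V = Fintype.card W) {f : ι → V} {g : ι → W} (hf : f.Injective)
    (hg : g.Injective) : ∃ e : V ≃ W, ∀ i, e (f i) = g i := by
  let e := Fintype.equivOfCardEq hVW
  obtain ⟨σ, hσ⟩ := Equiv.Perm.exists_extending_pair (e ∘ f) g (e.injective.comp hf) hg
  exact ⟨e.trans σ, hσ⟩

theorem nonempty_iso_doubleStar_iff [Fintype V] :
    Nonempty (G ≃g doubleStar 2 (Fintype.card V - 2)) ↔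
      ∃ v u p : V, v ≠ u ∧ v ≠ p ∧ u ≠ p ∧ G = broom v u p := by
  rw [doubleStar_two_eq_broom]
  constructor
  · rintro ⟨e⟩
    refine ⟨e.symm (.inr none), e.symm (.inl none), e.symm (.inl (some 0)), by simp, by simp,
      by simp, ?_⟩
    refine .trans ?_ (comap_broom e.toEquiv _ _ _)
    ext x y
    exact e.map_adj_iff.symm
  · rintro ⟨v, u, p, hvu, hvp, hup, rfl⟩
    have hcard : 2 < Fintype.card V := Fintype.two_lt_card_iff.2 ⟨v, u, p, hvu, hvp, hup⟩
    obtain ⟨e, he⟩ := exists_equiv_forall_apply_eq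
      (W := Option (Fin (2 - 1)) ⊕ Option (Fin (Fintype.card V - 2 - 1))) (by
        simp only [Fintype.card_sum, Fintype.card_option, Fintype.card_fin]
        omega)
      (f := ![v, u, p]) (g := ![.inr none, .inl none, .inl (some 0)])
      (List.nodup_ofFn.1 (by simp [hvu, hvp, hup])) (List.nodup_ofFn.1 (by simp))
    have hv : v = e.symm (.inr none) := (e.eq_symm_apply).2 (he 0)
    have hu : u = e.symm (.inl none) := (e.eq_symm_apply).2 (he 1)
    have hp : p = e.symm (.inl (some 0)) := (e.eq_symm_apply).2 (he 2)
    rw [hv, hu, hp, ← comap_broom]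
    exact ⟨Iso.comap e _⟩

end broom

/-- The broom with centres `v`, `u` in which the edge `v b` is exchanged for the edge `b b'`. -/
def switchedBroom (v u p b b' : V) : SimpleGraph V :=
  (broom v u p \ edge v b) ⊔ edge b b'

section switchedBroom

variable {v u p b b' : V}

theorem switchedBroom_adj : (switchedBroom v u p b b').Adj x y ↔
    (broom v u p).Adj x y ∧ s(x, y) ≠ s(v, b) ∨ x ≠ y ∧ s(x, y) = s(b, b') := by
  simp only [switchedBroom, sup_adj, sdiff_adj, edge_adj, Sym2.eq_iff, broom_adj]
  grind

theorem connected_switchedBroom (hvp : v ≠ p) (hvu : v ≠ u) (hup : u ≠ p) (hbv : b ≠ v)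
    (hbp : b ≠ p) (hb'u : b' ≠ u) (hbb' : b ≠ b') (hadj : ¬ (broom v u p).Adj b b') :
    (switchedBroom v u p b b').Connected := by
  rw [broom_adj] at hadj
  have hstar : ∀ z, z ≠ p → z ≠ b → (switchedBroom v u p b b').Reachable v z := by
    intro z hzp hzb
    obtain rfl | hzv := eq_or_ne v z
    · rfl
    · exact Adj.reachable (by rw [switchedBroom_adj, broom_adj]; grind)
  have hup' : (switchedBroom v u p b b').Adj u p := by rw [switchedBroom_adj, broom_adj]; grind
  have hb'b : (switchedBroom v u p b b').Adj b' b := by rw [switchedBroom_adj, broom_adj]; grind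
  have hb : (switchedBroom v u p b b').Reachable v b := by
    refine .trans ?_ hb'b.reachable
    obtain rfl | hb'p := eq_or_ne b' p
    · exact (hstar u hup (by grind)).trans hup'.reachable
    · exact hstar b' hb'p hbb'.symm
  have hu : (switchedBroom v u p b b').Reachable v u := by
    obtain rfl | hbu := eq_or_ne b u
    exacts [hb, hstar u hup hbu.symm]
  refine (connected_iff_exists_forall_reachable _).2 ⟨v, fun z => ?_⟩
  obtain rfl | hzp := eq_or_ne z p
  · exact hu.trans hup'.reachable
  obtain rfl | hzb := eq_or_ne z b
  exacts [hb, hstar z hzp hzb]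

theorem ncard_neighborSet_switchedBroom_center_le [Fintype V] (hvp : v ≠ p) (hvu : v ≠ u)
    (hbv : b ≠ v) (hbp : b ≠ p) (hb'v : b' ≠ v) :
    ((switchedBroom v u p b b').neighborSet v).ncard ≤ Fintype.card V - 3 := by
  have hsub : (switchedBroom v u p b b').neighborSet v ⊆ {v, p, b}ᶜ := by
    intro y hy
    simp only [mem_neighborSet, switchedBroom_adj, broom_adj, Sym2.eq_iff] at hy
    simp only [Set.mem_compl_iff, Set.mem_insert_iff, Set.mem_singleton_iff]
    grind
  have hle := Set.ncard_le_ncard hsub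
  rwa [Set.ncard_compl, Nat.card_eq_fintype_card,
    Set.ncard_eq_three.2 ⟨v, p, b, hvp, hbv.symm, hbp.symm, rfl⟩] at hle

theorem exists_neighborSet_switchedBroom_subset_pair {z : V} (hz : z ≠ v) (hvp : v ≠ p)
    (hvu : v ≠ u) (hup : u ≠ p) (hbv : b ≠ v) (hbp : b ≠ p) (hb'u : b' ≠ u) (hbb' : b ≠ b')
    (hadj : ¬ (broom v u p).Adj b b') :
    ∃ s t, (switchedBroom v u p b b').neighborSet z ⊆ {s, t} := by
  suffices ∃ s t, ∀ y, (switchedBroom v u p b b').Adj z y → y = s ∨ y = t from this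
  simp only [switchedBroom_adj, broom_adj, Sym2.eq_iff] at hadj ⊢
  obtain rfl | hzp := eq_or_ne z p
  · exact ⟨u, b, by grind⟩
  obtain rfl | hzb := eq_or_ne z b
  · exact ⟨p, b', by grind⟩
  obtain rfl | hzu := eq_or_ne z u
  · exact ⟨v, p, by grind⟩
  · exact ⟨v, b, by grind⟩

theorem properConnectionNumber_le_of_broom_sup_edge_le [Fintype V] (hn : 5 ≤ Fintype.card V)
    (hvp : v ≠ p) (hvu : v ≠ u) (hup : u ≠ p) (hbv : b ≠ v) (hbp : b ≠ p) (hb'v : b' ≠ v)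
    (hb'u : b' ≠ u) (hadj : ¬ (broom v u p).Adj b b') (hbb' : G.Adj b b')
    (hle : broom v u p ≤ G) : G.properConnectionNumber ≤ Fintype.card V - 3 := by
  have hsG : switchedBroom v u p b b' ≤ G :=
    sup_le (sdiff_le.trans hle) ((edge_le_iff G).2 (.inr hbb'))
  refine properConnectionNumber_le_of_degree_le hsG
    (connected_switchedBroom hvp hvu hup hbv hbp hb'u hbb'.ne hadj) (by omega) fun z => ?_
  obtain rfl | hz := eq_or_ne z v
  · exact ncard_neighborSet_switchedBroom_center_le hvp hvu hbv hbp hb'v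
  · obtain ⟨s, t, hst⟩ := exists_neighborSet_switchedBroom_subset_pair hz hvp hvu hup hbv hbp
      hb'u hbb'.ne hadj
    calc ((switchedBroom v u p b b').neighborSet z).ncard
        ≤ ({s, t} : Set V).ncard := Set.ncard_le_ncard hst
      _ ≤ ({t} : Set V).ncard + 1 := Set.ncard_insert_le s {t}
      _ ≤ Fintype.card V - 3 := by rw [Set.ncard_singleton]; omega

theorem broom_eq_or_properConnectionNumber_le [Fintype V] (hn : 5 ≤ Fintype.card V)
    (hvp : v ≠ p) (hup : G.Adj u p) (hv : G.neighborSet v = {v, p}ᶜ) :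
    G = broom v u p ∨ G.properConnectionNumber ≤ Fintype.card V - 3 := by
  have hadj : ∀ z, G.Adj v z ↔ z ≠ v ∧ z ≠ p := by
    intro z
    rw [← mem_neighborSet, hv, Set.mem_compl_iff, Set.mem_insert_iff, Set.mem_singleton_iff, not_or]
  have hvu : v ≠ u := fun h => ((hadj p).1 (h ▸ hup)).2 rfl
  have hle : broom v u p ≤ G := by
    intro x y hxy
    rw [broom_adj] at hxy
    grind [G.adj_comm x y]
  by_cases hge : G ≤ broom v u p
  · exact .inl (le_antisymm hge hle)
  obtain ⟨b, b', hbb', hnot⟩ : ∃ b b', G.Adj b b' ∧ ¬ (broom v u p).Adj b b' := by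
    simpa [SimpleGraph.le_iff_adj] using hge
  right
  wlog h : b ≠ p ∧ b' ≠ u generalizing b b'
  · refine this b' b hbb'.symm (fun h => hnot h.symm) ?_
    rw [broom_adj] at hnot
    grind [hbb'.ne, hup.ne]
  have hbv : b ≠ v := by
    rw [broom_adj] at hnot
    grind
  have hb'v : b' ≠ v := by
    rw [broom_adj] at hnot
    grind [hbb'.symm]
  exact properConnectionNumber_le_of_broom_sup_edge_le hn hvp hvu hup.ne hbv h.1 hb'v h.2 hnot
    hbb' hle

end switchedBroom

theorem neighborSet_subset_of_not_adj {v p : V} (h : ¬ G.Adj v p) : G.neighborSet v ⊆ {v, p}ᶜ := by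
  rintro z hz (rfl | rfl)
  exacts [hz.ne rfl, h hz]

theorem ncard_compl_pair [Fintype V] {v p : V} (hvp : v ≠ p) :
    ({v, p}ᶜ : Set V).ncard = Fintype.card V - 2 := by
  rw [Set.ncard_compl, Nat.card_eq_fintype_card, Set.ncard_pair hvp]

theorem exists_not_adj_of_connected_compl [Nontrivial V] (hGc : Gᶜ.Connected) (v : V) :
    ∃ p, v ≠ p ∧ ¬ G.Adj v p := by
  obtain ⟨p, hp⟩ := hGc.preconnected.exists_adj_of_nontrivial v
  exact ⟨p, (compl_adj _ _ _).1 hp⟩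

theorem two_le_properConnectionNumber_of_connected_compl [Finite V] [Nontrivial V]
    (hG : G.Connected) (hGc : Gᶜ.Connected) : 2 ≤ G.properConnectionNumber := by
  obtain ⟨p, hp, hadj⟩ := exists_not_adj_of_connected_compl hGc hG.nonempty.some
  exact two_le_properConnectionNumber hG hp hadj

theorem properConnectionNumber_le_card_sub_two [Fintype V] (hn : 3 ≤ Fintype.card V)
    (hG : G.Connected) (hGc : Gᶜ.Connected) :
    G.properConnectionNumber ≤ Fintype.card V - 2 := by
  have : Nontrivial V := Fintype.one_lt_card_iff_nontrivial.1 (by omega)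
  refine properConnectionNumber_le_of_degree_le le_rfl hG (by omega) fun v => ?_
  obtain ⟨p, hvp, hadj⟩ := exists_not_adj_of_connected_compl hGc v
  exact (Set.ncard_le_ncard (neighborSet_subset_of_not_adj hadj)).trans_eq (ncard_compl_pair hvp)

theorem card_sub_two_le_properConnectionNumber_broom [Fintype V] {v u p : V} (hvu : v ≠ u)
    (hvp : v ≠ p) (hup : u ≠ p) (hG : (broom v u p).Connected) :
    Fintype.card V - 2 ≤ (broom v u p).properConnectionNumber := by
  have hdeg := ncard_neighborSet_le_properConnectionNumber ⟨hG, isAcyclic_broom hvp hup⟩ v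
  rwa [neighborSet_broom hvu hvp, ncard_compl_pair hvp] at hdeg

theorem exists_eq_broom_of_card_sub_two_le [Fintype V] (hn : 5 ≤ Fintype.card V)
    (hG : G.Connected) (hGc : Gᶜ.Connected)
    (hpc : Fintype.card V - 2 ≤ G.properConnectionNumber) :
    ∃ v u p, v ≠ u ∧ v ≠ p ∧ u ≠ p ∧ G = broom v u p := by
  have : Nontrivial V := Fintype.one_lt_card_iff_nontrivial.1 (by omega)
  obtain ⟨v, hv⟩ : ∃ v, Fintype.card V - 3 < (G.neighborSet v).ncard := by
    by_contra! hdeg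
    have := properConnectionNumber_le_of_degree_le le_rfl hG (by omega) hdeg
    omega
  obtain ⟨p, hvp, hadj⟩ := exists_not_adj_of_connected_compl hGc v
  have hnbr : G.neighborSet v = {v, p}ᶜ :=
    Set.eq_of_subset_of_ncard_le (neighborSet_subset_of_not_adj hadj) <| by
      rw [ncard_compl_pair hvp]
      omega
  obtain ⟨u, hpu⟩ := hG.preconnected.exists_adj_of_nontrivial p
  have hvu : v ≠ u := fun h => hadj (h ▸ hpu.symm)
  refine ⟨v, u, p, hvu, hvp, hpu.ne', ?_⟩
  refine (broom_eq_or_properConnectionNumber_le hn hvp hpu.symm hnbr).resolve_right ?_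
  omega

theorem properConnectionNumber_eq_card_sub_two_iff [Fintype V] (hn : 5 ≤ Fintype.card V)
    (hG : G.Connected) (hGc : Gᶜ.Connected) :
    G.properConnectionNumber = Fintype.card V - 2 ↔
      Nonempty (G ≃g doubleStar 2 (Fintype.card V - 2)) := by
  rw [nonempty_iso_doubleStar_iff]
  refine ⟨fun h => exists_eq_broom_of_card_sub_two_le hn hG hGc h.ge, ?_⟩
  rintro ⟨v, u, p, hvu, hvp, hup, rfl⟩
  exact (properConnectionNumber_le_card_sub_two (by omega) hG hGc).antisymm
    (card_sub_two_le_properConnectionNumber_broom hvu hvp hup hG)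

end ProperConnection

theorem mainTheorem1 {V : Type*} [Fintype V] (G : SimpleGraph V) (n : ℕ)
    (hcard : Fintype.card V = n) (hn : 5 ≤ n) (hG : G.Connected) (hGc : Gᶜ.Connected) :
    4 ≤ G.properConnectionNumber + Gᶜ.properConnectionNumber ∧
    G.properConnectionNumber + Gᶜ.properConnectionNumber ≤ n ∧
    (G.properConnectionNumber + Gᶜ.properConnectionNumber = n ↔
      Nonempty (G ≃g SimpleGraph.doubleStar 2 (n - 2)) ∨
      Nonempty (Gᶜ ≃g SimpleGraph.doubleStar 2 (n - 2))) := by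
  subst hcard
  have : Nontrivial V := Fintype.one_lt_card_iff_nontrivial.1 (by omega)
  have hGcc : Gᶜᶜ.Connected := (compl_compl G).symm ▸ hG
  have hle_two : G.properConnectionNumber ≤ 2 ∨ Gᶜ.properConnectionNumber ≤ 2 :=
    (ProperConnection.hasAltColoring_or_hasAltColoring_compl hG hGc).imp
      (·.properConnectionNumber_le) (·.properConnectionNumber_le)
  have hG_ge := ProperConnection.two_le_properConnectionNumber_of_connected_compl hG hGc
  have hGc_ge := ProperConnection.two_le_properConnectionNumber_of_connected_compl hGc hGcc
  have hG_le := ProperConnection.properConnectionNumber_le_card_sub_two (by omega) hG hGc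
  have hGc_le := ProperConnection.properConnectionNumber_le_card_sub_two (by omega) hGc hGcc
  rw [← ProperConnection.properConnectionNumber_eq_card_sub_two_iff hn hG hGc,
    ← ProperConnection.properConnectionNumber_eq_card_sub_two_iff hn hGc hGcc]
  omega
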